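/- Let $A,B,C$ be points of the unit sphere $\mathbb S^2\subset\mathbb R^3$ with $\det M(A,B,C)>0$, where $M(U,V,W)$ is the $3\times 3$ matrix with columns $U,V,W$. For $U,V,W\in\mathbb S^2$ let $S(U,V,W)$ be the oriented area of the spherical triangle $UVW$, i.e. the surface area of the set of points of $\mathbb S^2$ that are non-negative linear combinations of $U,V,W$, multiplied by the sign of $\det M(U,V,W)$. Write $S=S(A,B,C)$ and, for $X\in\mathbb S^2$, $$S_A(X)=S(B,C,X),\quad S_B(X)=S(C,A,X),\quad S_C(X)=S(A,B,X),\qquad \lambda_i(X)=\frac{S_i(X)}{S},$$ $$M_A=M(B,C,X),\quad M_B=M(C,A,X),\quad M_C=M(A,B,X),$$ $$F_{BC}(X)=\Big[1-\frac{C\cdot(X+B)}{1+B\cdot X}\Big]B+\Big[1-\frac{B\cdot(X+C)}{1+C\cdot X}\Big]C,$$ and define $F_{CA},F_{AB},F_{AC},F_{BA},F_{CB}$ likewise by substituting the vertices. Let $d$ be the exterior derivative on $\mathbb S^2$ and let $dX$ be the $\mathbb R^3$-valued 1-form on $\mathbb S^2$ given by the differential of the inclusion $\mathbb S^2\hookrightarrow\mathbb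 R^3$. Then: 1. $\lambda_A(A)=\lambda_B(B)=\lambda_C(C)=1$, and $\lambda_A$, $\lambda_B$, $\lambda_C$ vanish on the sides $BC$, $CA$, $AB$ respectively. For every $X$ in the closed triangle $ABC$, $S_A(X)+S_B(X)+S_C(X)=S$ and $\lambda_A(X)+\lambda_B(X)+\lambda_C(X)=1$. 2. At every point $X$ of the closed triangle $ABC$ the functions $\lambda_A,\lambda_B,\lambda_C$ are differentiable on $\mathbb S^2$, with $$-S\det M_A\,d\lambda_A=F_{BC}\cdot dX,\quad -S\det M_B\,d\lambda_B=F_{CA}\cdot dX,\quad -S\det M_C\,d\lambda_C=F_{AB}\cdot dX.$$ Hence, wherever the determinant in the denominator is non-zero (in particular in the interior of the triangle), $$d\lambda_A=-\frac{F_{BC}}{S\det M_A}\cdot dX,\quad d\lambda_B=-\frac{F_{CA}}{S\det M_B}\cdot dX,\quad d\lambda_C=-\frac{F_{AB}}{S\det M_C}\cdot dX.$$ 3. The Whitney 1-forms $\lambda_{ij}=\lambda_i\,d\lambda_j-\lambda_j\,d\lambda_i$ satisfy, at every point of the closed triangle where the two determinants involved are non-zero, $$\lambda_{AB}=\frac1S\Big(\frac{\lambda_B}{\det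 M_A}F_{BC}-\frac{\lambda_A}{\det M_B}F_{AC}\Big)\cdot dX,$$ $$\lambda_{BC}=\frac1S\Big(\frac{\lambda_C}{\det M_B}F_{CA}-\frac{\lambda_B}{\det M_C}F_{BA}\Big)\cdot dX,$$ $$\lambda_{CA}=\frac1S\Big(\frac{\lambda_A}{\det M_C}F_{AB}-\frac{\lambda_C}{\det M_A}F_{CB}\Big)\cdot dX.$$ -/

import Mathlib

open scoped Manifold

noncomputable section

namespace SphericalTriangle

/-- Euclidean three-space. -/
abbrev E3 : Type := EuclideanSpace ℝ (Fin 3)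

/-- The unit sphere of `E3`. -/
abbrev S2 : Type := Metric.sphere (0 : E3) 1

instance finrank_E3 : Fact (Module.finrank ℝ E3 = 2 + 1) := ⟨by simp⟩

/-- The matrix `M(U, V, W)` whose columns are `U`, `V`, `W`. -/
def colMatrix (U V W : E3) : Matrix (Fin 3) (Fin 3) ℝ :=
  Matrix.of fun i j => (![U, V, W] j) i

/-- `det M(U, V, W)`. -/
def detM (U V W : E3) : ℝ := (colMatrix U V W).det

/-- The spherical triangle with vertices `A`, `B`, `C`, boundary included: the points of the sphere
that lie in the convex cone spanned by `A`, `B`, `C`. -/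
def triangle (A B C : S2) : Set S2 :=
  {X | ∃ a b c : ℝ, 0 ≤ a ∧ 0 ≤ b ∧ 0 ≤ c ∧ (X : E3) = a • (A : E3) + b • (B : E3) + c • (C : E3)}

/-- The great circle arc that joins two (non-antipodal) points `A` and `B`. -/
def arc (A B : S2) : Set S2 :=
  {X | ∃ a b : ℝ, 0 ≤ a ∧ 0 ≤ b ∧ (X : E3) = a • (A : E3) + b • (B : E3)}

/-- The oriented area of the spherical triangle `ABC`: its surface measure on the unit sphere, with
the sign of `det M(A, B, C)`. -/
def area (A B C : S2) : ℝ :=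
  (SignType.sign (detM A B C) : ℝ) *
    ((MeasureTheory.volume : MeasureTheory.Measure E3).toSphere).real (triangle A B C)

/-- The barycentric coordinate `λ_A(X) = S_A(X) / S`, where `S_A(X)` is the area of `BCX`. -/
def lamA (A B C X : S2) : ℝ := area B C X / area A B C

/-- The barycentric coordinate `λ_B(X) = S_B(X) / S`, where `S_B(X)` is the area of `CAX`. -/
def lamB (A B C X : S2) : ℝ := area C A X / area A B C

/-- The barycentric coordinate `λ_C(X) = S_C(X) / S`, where `S_C(X)` is the area of `ABX`. -/
def lamC (A B C X : S2) : ℝ := area A B X / area A B C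

/-- The vector field `F_{BC}` along the sphere:
`F_{BC}(X) = [1 - C ⬝ (X + B) / (1 + B ⬝ X)] B + [1 - B ⬝ (X + C) / (1 + C ⬝ X)] C`. -/
def F (B C X : S2) : E3 :=
  (1 - inner ℝ (C : E3) ((X : E3) + (B : E3)) / (1 + inner ℝ (B : E3) (X : E3))) • (B : E3) +
  (1 - inner ℝ (B : E3) ((X : E3) + (C : E3)) / (1 + inner ℝ (C : E3) (X : E3))) • (C : E3)

/-- The exterior derivative `df` of a function on the sphere, a 1-form. -/
def d (f : S2 → ℝ) (X : S2) : TangentSpace (𝓡 2) X →L[ℝ] ℝ := mvfderiv (𝓡 2) f X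

/-- The vector-valued 1-form `dX`: the differential of the inclusion of the sphere in `E3`. -/
def dX (X : S2) : TangentSpace (𝓡 2) X →L[ℝ] E3 := mvfderiv (𝓡 2) (fun Y : S2 => (Y : E3)) X

/-- The scalar 1-form `V ⬝ dX` at the point `X`. -/
def dotdX (V : E3) (X : S2) : TangentSpace (𝓡 2) X →L[ℝ] ℝ := (innerSL ℝ V).comp (dX X)

/-- The Whitney 1-form `λ_{ij} = λ_i dλ_j - λ_j dλ_i` of two barycentric coordinates. -/
def whitney (li lj : S2 → ℝ) (X : S2) : TangentSpace (𝓡 2) X →L[ℝ] ℝ :=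
  li X • d lj X - lj X • d li X

end SphericalTriangle

end

open SphericalTriangle

namespace SphericalTriangle
open MeasureTheory Set Real Filter Topology
open scoped ENNReal Pointwise

/-! Everything rests on the closed form S(U,V,W) = 2 arg(1 + U·V + V·W + W·U + i det M(U,V,W)),
valid whenever that number avoids the half-line (-∞, 0] (`area_eq_two_mul_arg`). It comes from
Girard's theorem: the area is the angle sum minus π, each angle is the argument of a vertex number,
and for a nondegenerate triangle the product of the three vertex numbers is a negative multiple of
the square of the number above (`vertexNumber_mul_mul`). Girard's theorem itself is
inclusion-exclusion on lunes, whose volumes are computed in cylindrical coordinates.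

The number is affine in the third vertex, so the differential of the area is the imaginary part of a
logarithmic derivative; Gram determinants turn it into F_BC (`neg_detM_mul_im_eq_inner_F`). For X in
the closed triangle, sides included, the number stays in the slit plane
(`halfAreaNumber_mem_slitPlane`).

The coordinates sum to one because X splits the triangle into three triangles that overlap in null
sets (`triangle_eq_union`, `aedisjoint_triangle`). The Whitney formulas are then linear algebra. -/

/-! ### Volumes of wedges and lunes in the unit ball -/

/-- The coordinates of `x` with respect to an orthonormal basis, grouped as a point of the plane
spanned by the first two vectors and a height. -/
theorem measurePreserving_coords (b : OrthonormalBasis (Fin 3) ℝ E3) :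
    MeasurePreserving (fun x : E3 => ((inner ℝ (b 0) x, inner ℝ (b 1) x), inner ℝ (b 2) x))
      (volume : Measure E3) (volume : Measure ((ℝ × ℝ) × ℝ)) := by
  have h1 := (volume_preserving_piFinSuccAbove (fun _ : Fin 3 => ℝ) 2).comp
    ((PiLp.volume_preserving_ofLp (Fin 3)).comp b.measurePreserving_repr)
  have h2 : MeasurePreserving (Prod.map id (MeasurableEquiv.finTwoArrow (α := ℝ)))
      (volume : Measure (ℝ × (Fin 2 → ℝ))) (volume : Measure (ℝ × ℝ × ℝ)) :=
    (MeasurePreserving.id volume).prod (volume_preserving_finTwoArrow ℝ)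
  have h3 := (Measure.measurePreserving_swap (μ := (volume : Measure ℝ))
    (ν := (volume : Measure (ℝ × ℝ)))).comp (h2.comp h1)
  convert! h3 using 1
  funext x
  simp only [Function.comp, Prod.map, Prod.swap, id]
  ext <;> simp [MeasurableEquiv.piFinSuccAbove, MeasurableEquiv.finTwoArrow, ← b.repr_apply_apply,
    Fin.succAbove] <;> rfl

/-- Above a planar point at radius r the ball has height 2√(1 - r²), whatever the angle, so in polar
coordinates Tonelli splits the volume into a radial integral times an angular measure. The real
square root vanishes for r > 1, so the radial integral may run over all r > 0. -/
theorem volume_ball_inter_wedge (b : OrthonormalBasis (Fin 3) ℝ E3) {S : Set (ℝ × ℝ)}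
    (hS : MeasurableSet S) {J : Set ℝ} (hJ : MeasurableSet J)
    (hSJ : ∀ r > 0, ∀ φ ∈ Ioo (-π) π, (r * cos φ, r * sin φ) ∈ S ↔ φ ∈ J) :
    volume ({x : E3 | (inner ℝ (b 0) x, inner ℝ (b 1) x) ∈ S} ∩ Metric.ball 0 1) =
      (∫⁻ r in Ioi (0 : ℝ), ENNReal.ofReal r * ENNReal.ofReal (√(1 - r ^ 2) + √(1 - r ^ 2))) *
        volume (J ∩ Ioo (-π) π) := by
  let g : ℝ × ℝ → ℝ := fun p => √(1 - (p.1 ^ 2 + p.2 ^ 2))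
  have hg : Measurable g := by fun_prop
  have hpre : {x : E3 | (inner ℝ (b 0) x, inner ℝ (b 1) x) ∈ S} ∩ Metric.ball 0 1 =
      (fun x : E3 => ((inner ℝ (b 0) x, inner ℝ (b 1) x), inner ℝ (b 2) x)) ⁻¹'
        regionBetween (-g) g S := by
    ext x
    have hn : ‖x‖ ^ 2 = inner ℝ (b 0) x ^ 2 + inner ℝ (b 1) x ^ 2 + inner ℝ (b 2) x ^ 2 := by
      rw [← b.sum_sq_norm_inner_right x]
      simp [Fin.sum_univ_three]
    have : ‖x‖ < 1 ↔ inner ℝ (b 2) x ^ 2 < 1 - (inner ℝ (b 0) x ^ 2 + inner ℝ (b 1) x ^ 2) := by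
      rw [← sq_lt_one_iff₀ (norm_nonneg x), hn]
      constructor <;> intro h <;> linarith
    simp only [mem_inter_iff, mem_ofPred_eq, mem_ball_zero_iff, regionBetween, mem_preimage,
      Pi.neg_apply, mem_Ioo, this, Real.sq_lt, g]
  rw [hpre, (measurePreserving_coords b).measure_preimage
    (measurableSet_regionBetween hg.neg hg hS).nullMeasurableSet]
  change (volume.prod volume) _ = _
  rw [volume_regionBetween_eq_lintegral' hg.neg hg hS, ← lintegral_indicator hS,
    ← lintegral_comp_polarCoord_symm]
  have : ∀ p ∈ polarCoord.target, ENNReal.ofReal p.1 • S.indicator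
        (fun a => ENNReal.ofReal ((g - -g) a)) (polarCoord.symm p) =
      (ENNReal.ofReal p.1 * ENNReal.ofReal (√(1 - p.1 ^ 2) + √(1 - p.1 ^ 2))) *
        J.indicator (fun _ => 1) p.2 := by
    rintro ⟨r, φ⟩ ⟨hr, hφ⟩
    have h2 : (r * cos φ) ^ 2 + (r * sin φ) ^ 2 = r ^ 2 := by
      linear_combination r ^ 2 * cos_sq_add_sin_sq φ
    by_cases h : φ ∈ J
    · rw [indicator_of_mem h, indicator_of_mem]
      · simp [g, polarCoord_symm_apply, h2]
      · simpa [polarCoord_symm_apply] using (hSJ r hr φ hφ).2 h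
    · rw [indicator_of_notMem h, indicator_of_notMem]
      · simp
      · simpa [polarCoord_symm_apply] using fun h' => h ((hSJ r hr φ hφ).1 h')
  rw [setLIntegral_congr_fun polarCoord.open_target.measurableSet this]
  change ∫⁻ p in Ioi (0 : ℝ) ×ˢ Ioo (-π) π, _ ∂(volume.prod volume) = _
  rw [← Measure.prod_restrict, lintegral_prod_mul
      (f := fun r : ℝ => ENNReal.ofReal r * ENNReal.ofReal (√(1 - r ^ 2) + √(1 - r ^ 2)))
      (g := J.indicator fun _ => (1 : ℝ≥0∞)) (by fun_prop)
      (measurable_const.indicator hJ).aemeasurable,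
    lintegral_indicator hJ, Measure.restrict_restrict hJ, setLIntegral_one]

/-- The radial integral is not computed directly: the whole ball, with volume 4π/3 and angular
measure 2π, forces it to be 2/3. -/
theorem volume_real_ball_inter_wedge (b : OrthonormalBasis (Fin 3) ℝ E3) {S : Set (ℝ × ℝ)}
    (hS : MeasurableSet S) {J : Set ℝ} (hJ : MeasurableSet J)
    (hSJ : ∀ r > 0, ∀ φ ∈ Ioo (-π) π, (r * cos φ, r * sin φ) ∈ S ↔ φ ∈ J) :
    volume.real ({x : E3 | (inner ℝ (b 0) x, inner ℝ (b 1) x) ∈ S} ∩ Metric.ball 0 1) =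
      2 / 3 * volume.real (J ∩ Ioo (-π) π) := by
  have h1 := volume_ball_inter_wedge b hS hJ hSJ
  have h2 := volume_ball_inter_wedge b MeasurableSet.univ MeasurableSet.univ (by simp)
  simp only [mem_univ, ofPred_true, univ_inter] at h2
  rw [EuclideanSpace.volume_ball_fin_three, Real.volume_Ioo] at h2
  set K := ∫⁻ r in Ioi (0 : ℝ), ENNReal.ofReal r * ENNReal.ofReal (√(1 - r ^ 2) + √(1 - r ^ 2))
  have hK : K.toReal = 2 / 3 := by
    have hπ := pi_pos
    have h3 := congrArg ENNReal.toReal h2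
    rw [ENNReal.toReal_mul, ENNReal.toReal_mul, ENNReal.toReal_ofReal (by positivity),
      ENNReal.toReal_ofReal (by linarith)] at h3
    simp only [ENNReal.ofReal_one, one_pow, ENNReal.toReal_one] at h3
    have : π * (K.toReal - 2 / 3) = 0 := by linarith
    rcases mul_eq_zero.1 this with h | h <;> linarith
  rw [measureReal_def, h1, ENNReal.toReal_mul, hK, measureReal_def]

/-- The part in the unit ball of the intersection of two half-spaces. -/
theorem volume_real_lune_of_unit {u v : E3} {θ : ℝ} (hu : ‖u‖ = 1) (hv : ‖v‖ = 1)
    (huv : inner ℝ u v = cos θ) (hθ : θ ∈ Ioo 0 π) :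
    volume.real ({x : E3 | 0 ≤ inner ℝ u x ∧ 0 ≤ inner ℝ v x} ∩ Metric.ball 0 1) =
      2 / 3 * (π - θ) := by
  have hs : 0 < sin θ := sin_pos_of_mem_Ioo hθ
  -- Gram-Schmidt: `u` sits at polar angle 0 and `v` at angle `θ` in the plane of `u` and `w`.
  set w : E3 := (sin θ)⁻¹ • (v - cos θ • u) with hw
  have huu : inner ℝ u u = (1 : ℝ) := by rw [real_inner_self_eq_norm_sq, hu, one_pow]
  have hvv : inner ℝ v v = (1 : ℝ) := by rw [real_inner_self_eq_norm_sq, hv, one_pow]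
  have huw : inner ℝ u w = (0 : ℝ) := by
    rw [hw, inner_smul_right, inner_sub_right, inner_smul_right, huv, huu]; ring
  have hww : ‖w‖ = 1 := by
    have : inner ℝ w w = (1 : ℝ) := by
      simp only [hw, inner_smul_right, inner_sub_right, inner_smul_left, inner_sub_left,
        huv, huu, hvv, real_inner_comm u v, conj_trivial]
      field_simp
      linear_combination -(sin_sq_add_cos_sq θ)
    rw [real_inner_self_eq_norm_sq] at this
    exact (pow_eq_one_iff_of_nonneg (norm_nonneg w) two_ne_zero).1 this
  obtain ⟨b, hb⟩ := Orthonormal.exists_orthonormalBasis_extension_of_card_eq (𝕜 := ℝ) (E := E3)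
    (ι := Fin 3) (by simp) (v := ![u, w, 0]) (s := {0, 1}) (by
      constructor
      · rintro ⟨i, rfl | rfl⟩ <;> simpa
      · rintro ⟨i, rfl | rfl⟩ ⟨j, rfl | rfl⟩ hij <;> simp_all [real_inner_comm u])
  have h0 : b 0 = u := by simpa using hb 0 (by simp)
  have h1 : b 1 = w := by simpa using hb 1 (by simp)
  have hvw (x : E3) : inner ℝ v x = cos θ * inner ℝ u x + sin θ * inner ℝ w x := by
    have : v = cos θ • u + sin θ • w := by
      rw [hw, smul_smul, mul_inv_cancel₀ hs.ne', one_smul]; abel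
    conv_lhs => rw [this]
    simp only [inner_add_left, inner_smul_left, conj_trivial]
  have key := volume_real_ball_inter_wedge b
    (S := {p | 0 ≤ p.1 ∧ 0 ≤ cos θ * p.1 + sin θ * p.2})
    ((measurableSet_le measurable_const measurable_fst).inter
      (measurableSet_le measurable_const
        ((measurable_fst.const_mul _).add (measurable_snd.const_mul _))))
    -- The half-planes are `cos φ ≥ 0` and `cos (φ - θ) ≥ 0`; they meet in an arc of length `π - θ`.
    (J := Icc (θ - π / 2) (π / 2)) measurableSet_Icc (by
      intro r hr φ hφ
      have e : cos θ * (r * cos φ) + sin θ * (r * sin φ) = r * cos (φ - θ) := by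
        rw [cos_sub]; ring
      simp only [mem_ofPred_eq, e, mul_nonneg_iff_of_pos_left hr, mem_Icc]
      obtain ⟨hθ0, hθ1⟩ := hθ
      obtain ⟨hφ0, hφ1⟩ := hφ
      constructor
      · rintro ⟨hc1, hc2⟩
        have hle : φ ≤ π / 2 := by
          by_contra! h
          linarith [cos_neg_of_pi_div_two_lt_of_lt h (by linarith)]
        have hge : -(π / 2) ≤ φ := by
          by_contra! h
          have := cos_neg_of_pi_div_two_lt_of_lt (x := -φ) (by linarith) (by linarith)
          rw [cos_neg] at this
          linarith
        refine ⟨?_, hle⟩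
        by_contra! h
        have := cos_neg_of_pi_div_two_lt_of_lt (x := -(φ - θ)) (by linarith) (by linarith)
        rw [cos_neg] at this
        linarith
      · rintro ⟨h1, h2⟩
        exact ⟨cos_nonneg_of_neg_pi_div_two_le_of_le (by linarith) h2,
          cos_nonneg_of_neg_pi_div_two_le_of_le (by linarith) (by linarith)⟩)
  have hJ : Icc (θ - π / 2) (π / 2) ∩ Ioo (-π) π = Icc (θ - π / 2) (π / 2) :=
    inter_eq_left.2 fun x hx => ⟨by linarith [hx.1, hθ.1, pi_pos], by linarith [hx.2, pi_pos]⟩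
  rw [hJ, Real.volume_real_Icc_of_le (by linarith [hθ.2])] at key
  simp only [h0, h1, mem_ofPred_eq, ← hvw] at key
  rw [key]
  ring

theorem volume_real_lune {m n : E3} (h : InnerProductGeometry.angle m n ∈ Ioo 0 π)
    (hm : m ≠ 0) (hn : n ≠ 0) :
    volume.real ({x : E3 | 0 ≤ inner ℝ m x ∧ 0 ≤ inner ℝ n x} ∩ Metric.ball 0 1) =
      2 / 3 * (π - InnerProductGeometry.angle m n) := by
  have hm' := norm_pos_iff.2 hm
  have hn' := norm_pos_iff.2 hn
  rw [← volume_real_lune_of_unit (u := ‖m‖⁻¹ • m) (v := ‖n‖⁻¹ • n)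
    (norm_smul_inv_norm (𝕜 := ℝ) hm) (norm_smul_inv_norm (𝕜 := ℝ) hn) _ h]
  · simp only [inner_smul_left, conj_trivial,
      mul_nonneg_iff_of_pos_left (inv_pos.2 hm'), mul_nonneg_iff_of_pos_left (inv_pos.2 hn')]
  · rw [InnerProductGeometry.cos_angle, inner_smul_left, inner_smul_right, conj_trivial]
    field_simp

/-! ### Girard's theorem for a trihedron -/

theorem volume_plane {n : E3} (hn : n ≠ 0) : volume {x : E3 | inner ℝ n x = 0} = 0 := by
  have h := Measure.addHaar_submodule (volume : Measure E3) (ℝ ∙ n)ᗮ (by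
    intro h
    have h1 : n ∈ (ℝ ∙ n)ᗮ := by rw [h]; exact Submodule.mem_top
    exact hn (inner_self_eq_zero.1 (Submodule.mem_orthogonal_singleton_iff_inner_right.1 h1)))
  convert! h using 2
  ext x
  exact Submodule.mem_orthogonal_singleton_iff_inner_right.symm

/-- **Girard's theorem**, in terms of the inner normals of the three sides. -/
theorem volume_real_trihedron {l m n : E3} (hl : l ≠ 0) (hm : m ≠ 0) (hn : n ≠ 0)
    (hlm : InnerProductGeometry.angle l m ∈ Ioo 0 π)
    (hmn : InnerProductGeometry.angle m n ∈ Ioo 0 π)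
    (hnl : InnerProductGeometry.angle n l ∈ Ioo 0 π) :
    3 * volume.real ({x : E3 | 0 ≤ inner ℝ l x ∧ 0 ≤ inner ℝ m x ∧ 0 ≤ inner ℝ n x} ∩
      Metric.ball 0 1) = 2 * π - (InnerProductGeometry.angle l m +
        InnerProductGeometry.angle m n + InnerProductGeometry.angle n l) := by
  let H (v : E3) : Set E3 := {x | 0 ≤ inner ℝ v x}
  have hH (v : E3) : MeasurableSet (H v) := measurableSet_le measurable_const (by fun_prop)
  let ν : Measure E3 := volume.restrict (Metric.ball 0 1)
  have : IsFiniteMeasure ν := ⟨by simp [ν]⟩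
  have hν {s : Set E3} (hs : MeasurableSet s) : ν.real s = volume.real (s ∩ Metric.ball 0 1) :=
    measureReal_restrict_apply hs
  have hneg {s : Set E3} (hs : MeasurableSet s) : ν.real ((fun x => -x) ⁻¹' s) = ν.real s := by
    have h := (Measure.measurePreserving_neg (volume : Measure E3)).restrict_preimage
      (Metric.isOpen_ball (x := (0 : E3)) (ε := 1)).measurableSet
    have e : (Neg.neg : E3 → E3) ⁻¹' Metric.ball 0 1 = Metric.ball 0 1 := by ext; simp
    rw [e] at h
    rw [measureReal_def, measureReal_def]
    exact congrArg _ (h.measure_preimage hs.nullMeasurableSet)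
  have hae {v : E3} (hv : v ≠ 0) : ∀ᵐ x ∂ν, inner ℝ v x ≠ 0 :=
    ae_restrict_of_ae (measure_eq_zero_iff_ae_notMem.1 (volume_plane hv))
  have hhalf : ν.real (H n) = 2 / 3 * π := by
    have h1 := measureReal_add_measureReal_compl (μ := ν) (hH n)
    have h2 : ν.real (H n)ᶜ = ν.real (H n) := by
      rw [← hneg (hH n)]
      apply measureReal_congr
      filter_upwards [hae hn] with x hx
      apply propext
      change ¬ 0 ≤ inner ℝ n x ↔ 0 ≤ inner ℝ n (-x)
      rw [inner_neg_right]
      constructor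
      · intro h; linarith
      · intro h h'; exact hx (by linarith)
    have h3 : ν.real univ = 4 / 3 * π := by
      rw [hν .univ, univ_inter, measureReal_def, EuclideanSpace.volume_ball_fin_three]
      rw [ENNReal.ofReal_one, one_pow, one_mul, ENNReal.toReal_ofReal (by positivity)]
      ring
    linarith
  have hL {u v : E3} (hu : u ≠ 0) (hv : v ≠ 0) (h : InnerProductGeometry.angle u v ∈ Ioo 0 π) :
      ν.real (H u ∩ H v) = 2 / 3 * (π - InnerProductGeometry.angle u v) := by
    rw [hν ((hH u).inter (hH v)), ← volume_real_lune h hu hv]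
    rfl
  -- With t the measure of the trihedron, `H l ∩ H m` is t plus the part outside `H n`. The
  -- antipodal map carries that part, up to null sets, to `H n` minus `H l` and `H m`, which is a
  -- half-ball less two lunes plus t. Hence 2t is the sum of the three lunes minus the half-ball.
  have e1 := measureReal_inter_add_sdiff (μ := ν) (s := H l ∩ H m) (hH n)
  have e2 : ν.real ((H l ∩ H m) \ H n) = ν.real ((H n \ H l) \ H m) := by
    rw [← hneg (((hH n).diff (hH l)).diff (hH m))]
    apply measureReal_congr
    filter_upwards [hae hl, hae hm, hae hn] with x h1 h2 h3
    apply propext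
    change (0 ≤ inner ℝ l x ∧ 0 ≤ inner ℝ m x) ∧ ¬ 0 ≤ inner ℝ n x ↔
      (0 ≤ inner ℝ n (-x) ∧ ¬ 0 ≤ inner ℝ l (-x)) ∧ ¬ 0 ≤ inner ℝ m (-x)
    simp only [inner_neg_right, not_le]
    constructor
    · rintro ⟨⟨a, b⟩, c⟩
      exact ⟨⟨by linarith, by linarith [lt_of_le_of_ne a h1.symm]⟩,
        by linarith [lt_of_le_of_ne b h2.symm]⟩
    · rintro ⟨⟨a, b⟩, c⟩
      exact ⟨⟨by linarith, by linarith⟩, lt_of_le_of_ne (by linarith) h3⟩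
  have e3 := measureReal_inter_add_sdiff (μ := ν) (s := H n) (hH l)
  have e4 := measureReal_inter_add_sdiff (μ := ν) (s := H n \ H l) (hH m)
  have e5 := measureReal_inter_add_sdiff (μ := ν) (s := H m ∩ H n) (hH l)
  have e6 : (H n \ H l) ∩ H m = (H m ∩ H n) \ H l := by ext; simp; tauto
  have e7 : H m ∩ H n ∩ H l = H l ∩ H m ∩ H n := by ext; simp; tauto
  have e8 : ν.real (H l ∩ H m ∩ H n) =
      volume.real ({x : E3 | 0 ≤ inner ℝ l x ∧ 0 ≤ inner ℝ m x ∧ 0 ≤ inner ℝ n x} ∩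
        Metric.ball 0 1) := by
    rw [hν (((hH l).inter (hH m)).inter (hH n)), inter_assoc (H l)]
    rfl
  rw [hL hl hm hlm] at e1
  rw [hL hn hl hnl] at e3
  rw [hL hm hn hmn, e7] at e5
  rw [e6] at e4
  linarith

/-! ### Determinants, cross products and Gram identities -/

theorem inner_eq_coords (u v : E3) : inner ℝ u v = u 0 * v 0 + u 1 * v 1 + u 2 * v 2 := by
  simp only [PiLp.inner_apply, Fin.sum_univ_three, RCLike.inner_apply, conj_trivial]
  ring

theorem detM_eq_coords (u v w : E3) : detM u v w =
    u 0 * (v 1 * w 2 - v 2 * w 1) + u 1 * (v 2 * w 0 - v 0 * w 2) +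
      u 2 * (v 0 * w 1 - v 1 * w 0) := by
  simp only [detM, colMatrix, Matrix.det_fin_three, Matrix.of_apply, Matrix.cons_val_zero,
    Matrix.cons_val_one, Matrix.cons_val_two, Matrix.head_cons, Matrix.tail_cons]
  ring

/-- The cross product in Euclidean three-space. -/
noncomputable def cross (u v : E3) : E3 :=
  !₂[u 1 * v 2 - u 2 * v 1, u 2 * v 0 - u 0 * v 2, u 0 * v 1 - u 1 * v 0]

theorem inner_cross (u v w : E3) : inner ℝ (cross u v) w = detM u v w := by
  simp [inner_eq_coords, detM_eq_coords, cross]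
  ring

theorem inner_cross_cross (a b c e : E3) : inner ℝ (cross a b) (cross c e) =
    inner ℝ a c * inner ℝ b e - inner ℝ a e * inner ℝ b c := by
  simp [inner_eq_coords, cross]
  ring

theorem detM_rotate (u v w : E3) : detM u v w = detM v w u := by
  simp only [detM_eq_coords]; ring

theorem detM_swap (u v w : E3) : detM u w v = -detM u v w := by
  simp only [detM_eq_coords]; ring

theorem detM_self_right (u v : E3) : detM u v v = 0 := by
  simp only [detM_eq_coords]; ring

theorem detM_self_outer (u v : E3) : detM u v u = 0 := by
  simp only [detM_eq_coords]; ring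

theorem detM_add (u v w w' : E3) : detM u v (w + w') = detM u v w + detM u v w' := by
  simp only [← inner_cross, inner_add_right]

theorem detM_smul (r : ℝ) (u v w : E3) : detM u v (r • w) = r * detM u v w := by
  simp only [← inner_cross, inner_smul_right]

/-- **Cramer's rule.** -/
theorem detM_smul_eq (u v w x : E3) :
    detM u v w • x = detM v w x • u + detM w u x • v + detM u v x • w := by
  ext i
  fin_cases i <;> simp [detM_eq_coords] <;> ring

/-- The product is the determinant of M(u,v,w)ᵀ M(u,v,x), a matrix of inner products, expanded along
its first row. -/
theorem detM_mul_detM (u v w x : E3) : detM u v w * detM u v x =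
    inner ℝ u u * (inner ℝ v v * inner ℝ w x - inner ℝ v x * inner ℝ v w) -
    inner ℝ u v * (inner ℝ u v * inner ℝ w x - inner ℝ v x * inner ℝ u w) +
    inner ℝ u x * (inner ℝ u v * inner ℝ v w - inner ℝ v v * inner ℝ u w) := by
  simp only [detM_eq_coords, inner_eq_coords]
  ring

theorem inner_self_sphere (X : S2) : inner ℝ (X : E3) (X : E3) = (1 : ℝ) := by
  rw [real_inner_self_eq_norm_sq, norm_eq_of_mem_sphere, one_pow]

theorem detM_sq (A B C : S2) : detM A B C ^ 2 =
    1 + 2 * inner ℝ (A : E3) (B : E3) * inner ℝ (B : E3) (C : E3) * inner ℝ (C : E3) (A : E3) -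
      inner ℝ (A : E3) (B : E3) ^ 2 - inner ℝ (B : E3) (C : E3) ^ 2 -
      inner ℝ (C : E3) (A : E3) ^ 2 := by
  rw [pow_two, detM_mul_detM]
  simp only [inner_self_sphere, real_inner_comm (C : E3) (A : E3)]
  ring

theorem abs_inner_sphere_le (A B : S2) : |inner ℝ (A : E3) (B : E3)| ≤ (1 : ℝ) := by
  simpa [norm_eq_of_mem_sphere] using abs_real_inner_le_norm (A : E3) (B : E3)

/-! ### Angles and areas as arguments of complex numbers -/

/-- The complex number `(B ⬝ B)(A ⬝ C) - (A ⬝ B)(B ⬝ C) + i det M(A, B, C)`, whose argument is the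
angle at `B` of the spherical triangle `ABC`. -/
noncomputable def vertexNumber (A B C : E3) : ℂ :=
  ⟨inner ℝ A C - inner ℝ A B * inner ℝ B C, detM A B C⟩

/-- The complex number `1 + A ⬝ B + B ⬝ C + C ⬝ A + i det M(A, B, C)`, whose argument is half the
oriented area of the spherical triangle `ABC`. -/
noncomputable def halfAreaNumber (A B C : E3) : ℂ :=
  ⟨1 + inner ℝ A B + inner ℝ B C + inner ℝ C A, detM A B C⟩

theorem arg_mem_Ioo_of_im_pos {z : ℂ} (hz : 0 < z.im) : z.arg ∈ Ioo 0 π := by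
  have h0 := Complex.arg_nonneg_iff.2 hz.le
  have h1 : z.arg ≠ 0 := fun h => hz.ne' (Complex.arg_eq_zero_iff.1 h).2
  have h2 : z.arg ≠ π := fun h => hz.ne' (Complex.arg_eq_pi_iff.1 h).2
  exact ⟨lt_of_le_of_ne h0 h1.symm, lt_of_le_of_ne (Complex.arg_le_pi z) h2⟩

/-- The real part of the vertex number is -(A×B)·(B×C) because B is a unit vector, and by the Gram
identity its modulus is |A×B| |B×C|. The sign accounts for the supplement: the angle of the triangle
is π minus the angle between the inner normals. -/
theorem angle_cross_cross {A C : E3} (B : S2) (h : 0 < detM A B C) :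
    InnerProductGeometry.angle (cross A B) (cross B C) = π - (vertexNumber A B C).arg := by
  have hz : vertexNumber A B C ≠ 0 := fun h' => h.ne' (congrArg Complex.im h')
  have hnorm : ‖vertexNumber A B C‖ = ‖cross A B‖ * ‖cross B C‖ := by
    rw [← sq_eq_sq₀ (norm_nonneg _) (by positivity), Complex.sq_norm, Complex.normSq_apply, mul_pow,
      ← real_inner_self_eq_norm_sq, ← real_inner_self_eq_norm_sq, inner_cross_cross,
      inner_cross_cross]
    simp only [vertexNumber]
    have := detM_mul_detM A B C C
    rw [inner_self_sphere] at this ⊢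
    rw [real_inner_comm A (B : E3), real_inner_comm (B : E3) C]
    linear_combination this
  rw [Complex.arg_of_im_nonneg_of_ne_zero h.le hz, InnerProductGeometry.angle, ← arccos_neg, hnorm,
    inner_cross_cross, inner_self_sphere]
  congr 1
  simp only [vertexNumber]
  ring

/-- A region of the sphere cut out by a cone has three times the volume of the solid cone. -/
theorem toSphere_real_preimage {Q : Set E3} (hQ : MeasurableSet Q)
    (hcone : ∀ r : ℝ, 0 < r → ∀ x, r • x ∈ Q ↔ x ∈ Q) :
    (volume : Measure E3).toSphere.real ((↑) ⁻¹' Q : Set S2) =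
      3 * volume.real (Q ∩ Metric.ball 0 1) := by
  have h : Ioo (0 : ℝ) 1 • ((↑) '' ((↑) ⁻¹' Q : Set S2) : Set E3) =
      (Q ∩ Metric.ball 0 1) \ {0} := by
    ext x
    constructor
    · rintro ⟨r, ⟨hr0, hr1⟩, _, ⟨y, hy, rfl⟩, rfl⟩
      have hn : ‖r • (y : E3)‖ = r := by simp [norm_smul, abs_of_pos hr0]
      refine ⟨⟨(hcone r hr0 _).2 hy, by simpa [hn] using hr1⟩, fun h0 => ?_⟩
      rw [mem_singleton_iff] at h0
      simp only [h0, norm_zero] at hn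
      exact hr0.ne hn
    · rintro ⟨⟨hx, hb⟩, h0⟩
      have hpos : 0 < ‖x‖ := norm_pos_iff.2 h0
      refine ⟨‖x‖, ⟨hpos, by simpa using hb⟩, ‖x‖⁻¹ • x, ⟨⟨‖x‖⁻¹ • x, ?_⟩, ?_, rfl⟩, ?_⟩
      · simp [norm_smul, hpos.ne']
      · exact (hcone _ (inv_pos.2 hpos) _).2 hx
      · exact smul_inv_smul₀ hpos.ne' x
  -- The factor 3 is the dimension in the definition of `toSphere`; removing the origin costs
  -- nothing.
  rw [measureReal_def, Measure.toSphere_apply' _ (measurable_subtype_coe hQ), h,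
    measure_sdiff_null (measure_singleton _), ENNReal.toReal_mul, measureReal_def]
  simp

theorem triangle_eq_preimage {A B C : S2} (h : 0 < detM A B C) : triangle A B C =
    (↑) ⁻¹' {x : E3 | 0 ≤ inner ℝ (cross A B) x ∧ 0 ≤ inner ℝ (cross B C) x ∧
      0 ≤ inner ℝ (cross C A) x} := by
  ext X
  simp only [triangle, mem_ofPred_eq, mem_preimage, inner_cross]
  constructor
  · rintro ⟨a, b, c, ha, hb, hc, hX⟩
    have h1 := detM_rotate A B C
    have h2 := detM_rotate B C A
    simp only [hX, detM_add, detM_smul, detM_self_right, detM_self_outer, ← h2, ← h1]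
    simp only [mul_zero, zero_add, add_zero]
    exact ⟨by positivity, by positivity, by positivity⟩
  · rintro ⟨h1, h2, h3⟩
    refine ⟨detM B C X / detM A B C, detM C A X / detM A B C, detM A B X / detM A B C,
      by positivity, by positivity, by positivity, ?_⟩
    have := detM_smul_eq A B C X
    rw [div_eq_inv_mul, div_eq_inv_mul, div_eq_inv_mul, mul_smul, mul_smul, mul_smul, ← smul_add,
      ← smul_add, ← this, inv_smul_smul₀ h.ne']

theorem cross_ne_zero_of_detM_ne_zero {u v w : E3} (h : detM u v w ≠ 0) : cross u v ≠ 0 :=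
  fun h0 => h (by rw [← inner_cross, h0, inner_zero_left])

/-- **Girard's theorem**: the area of a spherical triangle is its angle excess. -/
theorem area_eq_sum_arg {A B C : S2} (h : 0 < detM A B C) :
    area A B C = (vertexNumber A B C).arg + (vertexNumber B C A).arg +
      (vertexNumber C A B).arg - π := by
  have h1 : 0 < detM B C A := by rwa [← detM_rotate]
  have h2 : 0 < detM C A B := by rwa [← detM_rotate]
  have mem {z : ℂ} (hz : 0 < z.im) : π - z.arg ∈ Ioo 0 π := by
    have := arg_mem_Ioo_of_im_pos hz
    exact ⟨by linarith [this.2], by linarith [this.1]⟩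
  have e1 := angle_cross_cross B h
  have e2 := angle_cross_cross C h1
  have e3 := angle_cross_cross A h2
  have key := volume_real_trihedron (cross_ne_zero_of_detM_ne_zero h.ne')
    (cross_ne_zero_of_detM_ne_zero h1.ne') (cross_ne_zero_of_detM_ne_zero h2.ne')
    (e1 ▸ mem h) (e2 ▸ mem h1) (e3 ▸ mem h2)
  rw [area, sign_pos h, SignType.coe_one, one_mul, triangle_eq_preimage h, toSphere_real_preimage,
    key, e1, e2, e3]
  · ring
  · have (v : E3) : MeasurableSet {x : E3 | 0 ≤ inner ℝ v x} :=
      measurableSet_le measurable_const (by fun_prop)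
    exact (this _).inter ((this _).inter (this _))
  · intro r hr x
    simp only [mem_ofPred_eq, inner_smul_right, mul_nonneg_iff_of_pos_left hr]

/-- Multiplicative form of the angle excess: on arguments, the minus sign contributes π and the
square doubles the half area. Both sides are polynomials in the determinant and the three inner
products, equal modulo the Gram relation `detM_sq`. -/
theorem vertexNumber_mul_mul (A B C : S2) :
    vertexNumber A B C * vertexNumber B C A * vertexNumber C A B =
      -((((1 - inner ℝ (A : E3) (B : E3)) * (1 - inner ℝ (B : E3) (C : E3)) *
        (1 - inner ℝ (C : E3) (A : E3)) / 2 : ℝ) : ℂ) *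
        (halfAreaNumber A B C * halfAreaNumber A B C)) := by
  have hd := detM_sq A B C
  have e1 := detM_rotate A B C
  have e2 := detM_rotate B C A
  have f1 := real_inner_comm (C : E3) (A : E3)
  have f2 := real_inner_comm (A : E3) (B : E3)
  have f3 := real_inner_comm (B : E3) (C : E3)
  apply Complex.ext <;>
  simp only [vertexNumber, halfAreaNumber, Complex.mul_re, Complex.mul_im, Complex.neg_re,
    Complex.neg_im, Complex.ofReal_re, Complex.ofReal_im, ← e2, ← e1, f1, f2, f3] <;>
  generalize detM A B C = d at * <;>
  generalize (inner ℝ (A : E3) (B : E3) : ℝ) = x at * <;>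
  generalize (inner ℝ (B : E3) (C : E3) : ℝ) = y at * <;>
  generalize (inner ℝ (C : E3) (A : E3) : ℝ) = z at *
  · linear_combination (-((z - x * y) + (x - y * z) + (y - z * x)) -
      (1 - x) * (1 - y) * (1 - z) / 2) * hd
  · linear_combination -d * hd

theorem area_neg_swap (A B C : S2) : area A C B = -area A B C := by
  have : triangle A C B = triangle A B C := by
    ext X
    constructor <;> rintro ⟨a, b, c, ha, hb, hc, h⟩ <;>
      exact ⟨a, c, b, ha, hc, hb, by rw [h]; abel⟩
  rw [area, area, this, detM_swap, Left.sign_neg, SignType.coe_neg, neg_mul]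

theorem triangle_rotate (A B C : S2) : triangle A B C = triangle B C A := by
  ext X
  constructor
  · rintro ⟨a, b, c, ha, hb, hc, h⟩
    exact ⟨b, c, a, hb, hc, ha, by rw [h]; abel⟩
  · rintro ⟨a, b, c, ha, hb, hc, h⟩
    exact ⟨c, a, b, hc, ha, hb, by rw [h]; abel⟩

theorem area_rotate (A B C : S2) : area A B C = area B C A := by
  rw [area, area, triangle_rotate, detM_rotate]

theorem area_eq_zero_of_detM_eq_zero {A B C : S2} (h : detM A B C = 0) : area A B C = 0 := by
  simp [area, h]

theorem area_eq_measure {A B C : S2} (h : 0 < detM A B C) :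
    area A B C = (volume : Measure E3).toSphere.real (triangle A B C) := by
  rw [area, sign_pos h, SignType.coe_one, one_mul]

/-- Taking arguments in `vertexNumber_mul_mul` gives equality modulo 2π. The area lies in [0, 2π),
since each angle is below π, and twice the argument lies in (0, 2π), so the two agree. -/
theorem area_eq_two_mul_arg_of_detM_pos {A B C : S2} (h : 0 < detM A B C) :
    area A B C = 2 * (halfAreaNumber A B C).arg := by
  have h1 : 0 < detM B C A := by rwa [← detM_rotate]
  have h2 : 0 < detM C A B := by rwa [← detM_rotate]
  have ne {z : ℂ} (hz : 0 < z.im) : z ≠ 0 := fun h0 => hz.ne' (by rw [h0, Complex.zero_im])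
  have hv1 := ne (z := vertexNumber A B C) h
  have hv2 := ne (z := vertexNumber B C A) h1
  have hv3 := ne (z := vertexNumber C A B) h2
  have hw := ne (z := halfAreaNumber A B C) h
  have hprod := vertexNumber_mul_mul A B C
  set k : ℝ := (1 - inner ℝ (A : E3) (B : E3)) * (1 - inner ℝ (B : E3) (C : E3)) *
    (1 - inner ℝ (C : E3) (A : E3)) / 2 with hk
  -- Cauchy-Schwarz gives `0 ≤ k`; `k = 0` would make the product of three nonzero vertex numbers
  -- vanish.
  have hk0 : 0 < k := by
    refine lt_of_le_of_ne ?_ fun h0 => ?_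
    · have := (abs_le.1 (abs_inner_sphere_le A B)).2
      have := (abs_le.1 (abs_inner_sphere_le B C)).2
      have := (abs_le.1 (abs_inner_sphere_le C A)).2
      exact div_nonneg (mul_nonneg (mul_nonneg (by linarith) (by linarith)) (by linarith)) two_pos.le
    · rw [← h0, Complex.ofReal_zero, zero_mul, neg_zero] at hprod
      exact mul_ne_zero (mul_ne_zero hv1 hv2) hv3 hprod
  have hangle : ((area A B C : ℝ) : Real.Angle) = ((2 * (halfAreaNumber A B C).arg : ℝ) : Angle) := by
    rw [area_eq_sum_arg h, Angle.coe_sub, Angle.coe_add, Angle.coe_add,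
      ← Complex.arg_mul_coe_angle hv1 hv2, ← Complex.arg_mul_coe_angle (mul_ne_zero hv1 hv2) hv3,
      hprod, Complex.arg_neg_coe_angle (mul_ne_zero (by exact_mod_cast hk0.ne')
        (mul_ne_zero hw hw)), Complex.arg_real_mul _ hk0, Complex.arg_mul_coe_angle hw hw, two_mul,
      Angle.coe_add]
    abel
  obtain ⟨m, hm⟩ := Angle.angle_eq_iff_two_pi_dvd_sub.1 hangle
  have b0 : 0 ≤ area A B C := by rw [area_eq_measure h]; exact measureReal_nonneg
  have b1 : area A B C < 2 * π := by
    rw [area_eq_sum_arg h]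
    linarith [(arg_mem_Ioo_of_im_pos (z := vertexNumber A B C) h).2,
      (arg_mem_Ioo_of_im_pos (z := vertexNumber B C A) h1).2,
      (arg_mem_Ioo_of_im_pos (z := vertexNumber C A B) h2).2]
  have b2 := arg_mem_Ioo_of_im_pos (z := halfAreaNumber A B C) h
  have hπ := pi_pos
  have m1 : m < 1 := by
    have : 2 * π * m < 2 * π * 1 := by linarith [b2.1]
    exact_mod_cast lt_of_mul_lt_mul_left this (by positivity)
  have m2 : -1 < m := by
    have : 2 * π * (-1 : ℝ) < 2 * π * m := by linarith [b2.2]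
    exact_mod_cast lt_of_mul_lt_mul_left this (by positivity)
  obtain rfl : m = 0 := by omega
  rw [Int.cast_zero, mul_zero] at hm
  linarith

/-- Swapping two vertices negates the area and conjugates the number, and conjugation negates the
argument off the negative axis. Covering all orientations at once is what allows differentiation
across the great circle through a side. -/
theorem area_eq_two_mul_arg {A B C : S2} (h : halfAreaNumber A B C ∈ Complex.slitPlane) :
    area A B C = 2 * (halfAreaNumber A B C).arg := by
  rcases lt_trichotomy (detM A B C) 0 with hd | hd | hd
  · have hd' : 0 < detM A C B := by rw [detM_swap]; linarith
    have hconj : halfAreaNumber A C B = (starRingEnd ℂ) (halfAreaNumber A B C) := by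
      apply Complex.ext
      · simp only [halfAreaNumber, Complex.conj_re]
        rw [real_inner_comm (C : E3) (A : E3), real_inner_comm (A : E3) (B : E3),
          real_inner_comm (B : E3) (C : E3)]
        ring
      · exact detM_swap A B C
    have := area_eq_two_mul_arg_of_detM_pos hd'
    rw [area_neg_swap, hconj, Complex.arg_conj,
      if_neg (Complex.mem_slitPlane_iff_arg.1 h).1] at this
    linarith
  · rw [area_eq_zero_of_detM_eq_zero hd, eq_comm, mul_eq_zero, or_iff_right two_ne_zero,
      Complex.arg_eq_zero_iff]
    rcases h with h | h
    · exact ⟨h.le, hd⟩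
    · exact absurd hd h
  · exact area_eq_two_mul_arg_of_detM_pos hd

theorem area_pos {A B C : S2} (h : 0 < detM A B C) : 0 < area A B C := by
  rw [area_eq_two_mul_arg_of_detM_pos h]
  exact mul_pos two_pos (arg_mem_Ioo_of_im_pos (z := halfAreaNumber A B C) h).1

/-! ### The differential of the area -/

/-- The imaginary part is the derivative of the argument along the tangent vector v. By the Gram
relation the squared modulus factors as 2(1 + B·C)(1 + C·X)(1 + B·X); once these denominators are
cleared, the identity follows from the Gram formulas for det M(B,C,X)² and det M(B,C,X) det
M(B,C,v). -/
theorem neg_detM_mul_im_eq_inner_F {B C X : S2} {v : E3} (hv : inner ℝ (X : E3) v = (0 : ℝ))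
    (hBC : 1 + inner ℝ (B : E3) (C : E3) ≠ (0 : ℝ)) (hBX : 1 + inner ℝ (B : E3) (X : E3) ≠ (0 : ℝ))
    (hCX : 1 + inner ℝ (C : E3) (X : E3) ≠ (0 : ℝ)) :
    -detM B C X * (2 * ((halfAreaNumber B C X)⁻¹ *
      (⟨inner ℝ ((B : E3) + C) v, detM B C v⟩ : ℂ)).im) = inner ℝ (F B C X) v := by
  have hd := detM_sq B C X
  have hde := detM_mul_detM (B : E3) C X v
  have f1 := real_inner_comm (B : E3) (X : E3)
  have f2 := real_inner_comm (B : E3) (C : E3)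
  have hN : Complex.normSq (halfAreaNumber B C X) = 2 * (1 + inner ℝ (B : E3) (C : E3)) *
      (1 + inner ℝ (C : E3) (X : E3)) * (1 + inner ℝ (B : E3) (X : E3)) := by
    rw [Complex.normSq_apply]
    simp only [halfAreaNumber, f1] at hd ⊢
    linear_combination hd
  simp only [F, inner_add_left, inner_smul_left, inner_add_right, conj_trivial, Complex.mul_im,
    Complex.inv_re, Complex.inv_im, hN]
  simp only [halfAreaNumber, inner_self_sphere, hv, f1, f2] at hd hde ⊢
  generalize detM B C X = D at *
  generalize detM B C v = E at *
  generalize (inner ℝ (B : E3) (C : E3) : ℝ) = p at *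
  generalize (inner ℝ (C : E3) (X : E3) : ℝ) = q at *
  generalize (inner ℝ (B : E3) (X : E3) : ℝ) = r at *
  generalize (inner ℝ (B : E3) v : ℝ) = β at *
  generalize (inner ℝ (C : E3) v : ℝ) = γ at *
  field_simp
  linear_combination (β + γ) * hd - (1 + p + q + r) * hde

/-- The linear part of the affine map `Y ↦ halfAreaNumber B C Y`. -/
noncomputable def halfAreaNumberLinear (B C : E3) : E3 →L[ℝ] ℂ :=
  Complex.equivRealProdCLM.symm.toContinuousLinearMap ∘L
    (innerSL ℝ (B + C)).prod (innerSL ℝ (cross B C))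

theorem halfAreaNumberLinear_apply (B C v : E3) :
    halfAreaNumberLinear B C v = ⟨inner ℝ (B + C) v, detM B C v⟩ := by
  apply Complex.ext <;> simp [halfAreaNumberLinear, inner_cross, inner_add_left]

theorem hasFDerivAt_halfAreaNumber (B C Y : E3) :
    HasFDerivAt (halfAreaNumber B C) (halfAreaNumberLinear B C) Y := by
  have h : halfAreaNumber B C =
      fun Y => ((1 + inner ℝ B C : ℝ) : ℂ) + halfAreaNumberLinear B C Y := by
    funext Y
    rw [halfAreaNumberLinear_apply]
    apply Complex.ext
    · simp only [halfAreaNumber, Complex.add_re, Complex.ofReal_re, inner_add_left,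
        real_inner_comm B Y]
      ring
    · simp [halfAreaNumber]
  rw [h]
  exact (halfAreaNumberLinear B C).hasFDerivAt.const_add _

/-- The argument is the imaginary part of the logarithm, which is differentiable on the slit plane.
-/
theorem hasFDerivAt_arg_halfAreaNumber {B C Y : E3}
    (h : halfAreaNumber B C Y ∈ Complex.slitPlane) :
    HasFDerivAt (fun Y => (halfAreaNumber B C Y).arg)
      (Complex.imCLM ∘L ((halfAreaNumber B C Y)⁻¹ • halfAreaNumberLinear B C)) Y := by
  have h1 := ((Complex.hasDerivAt_log h).hasFDerivAt.restrictScalars ℝ).comp Y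
    (hasFDerivAt_halfAreaNumber B C Y)
  have h2 := Complex.imCLM.hasFDerivAt.comp Y h1
  simp only [Function.comp_def, Complex.imCLM_apply, Complex.log_im] at h2
  convert! h2 using 1
  ext v
  simp [mul_comm]

theorem inner_dX (X : S2) (t : TangentSpace (𝓡 2) X) : inner ℝ (X : E3) (dX X t) = (0 : ℝ) := by
  have h : dX X t ∈ (ℝ ∙ (X : E3))ᗮ := by
    rw [← range_mvfderiv_subtypeVal (n := 2) X]
    exact ⟨t, rfl⟩
  exact Submodule.mem_orthogonal_singleton_iff_inner_right.1 h

theorem mdifferentiableAt_and_d_area_div {B C X : S2} {S : ℝ} (hS : S ≠ 0)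
    (h : halfAreaNumber B C X ∈ Complex.slitPlane)
    (hBC : 1 + inner ℝ (B : E3) (C : E3) ≠ (0 : ℝ)) (hBX : 1 + inner ℝ (B : E3) (X : E3) ≠ (0 : ℝ))
    (hCX : 1 + inner ℝ (C : E3) (X : E3) ≠ (0 : ℝ)) :
    MDifferentiableAt (𝓡 2) 𝓘(ℝ, ℝ) (fun Y => area B C Y / S) X ∧
      -(S * detM B C X) • d (fun Y => area B C Y / S) X = dotdX (F B C X) X := by
  have hG := ((hasFDerivAt_arg_halfAreaNumber h).const_mul 2).mul_const S⁻¹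
  have hcoe : MDifferentiableAt (𝓡 2) 𝓘(ℝ, E3) (fun Y : S2 => (Y : E3)) X :=
    (contMDiff_coe_sphere (m := 1) X).mdifferentiableAt one_ne_zero
  -- The slit plane is open, so near X the area is the restriction to the sphere of a function
  -- differentiable at X in the ambient space.
  have hev : (fun Y => area B C Y / S) =ᶠ[𝓝 X]
      (fun Y : E3 => 2 * (halfAreaNumber B C Y).arg * S⁻¹) ∘ fun Y : S2 => (Y : E3) := by
    have hc : ContinuousAt (fun Y : S2 => halfAreaNumber B C Y) X :=
      (hasFDerivAt_halfAreaNumber B C X).continuousAt.comp continuous_subtype_val.continuousAt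
    filter_upwards [hc.eventually_mem (Complex.isOpen_slitPlane.mem_nhds h)] with Y hY
    rw [area_eq_two_mul_arg hY, div_eq_mul_inv]
    rfl
  have hf := (hG.hasMFDerivAt.comp X hcoe.hasMFDerivAt).congr_of_eventuallyEq hev
  refine ⟨hf.mdifferentiableAt, ?_⟩
  ext t
  have hd : d (fun Y => area B C Y / S) X t =
      S⁻¹ * (2 * ((halfAreaNumber B C X)⁻¹ * halfAreaNumberLinear B C (dX X t)).im) := by
    change mfderiv (𝓡 2) 𝓘(ℝ, ℝ) _ X t = _
    rw [hf.mfderiv]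
    rfl
  change -(S * detM B C X) * d (fun Y => area B C Y / S) X t = inner ℝ (F B C X) (dX X t)
  rw [hd, halfAreaNumberLinear_apply, ← neg_detM_mul_im_eq_inner_F (inner_dX X t) hBC hBX hCX]
  field_simp

theorem one_add_inner_ne_zero {A B : S2} (h : (A : E3) ≠ -B) :
    1 + inner ℝ (A : E3) (B : E3) ≠ (0 : ℝ) := by
  intro h0
  have : inner ℝ ((A : E3) + B) ((A : E3) + B) = (0 : ℝ) := by
    rw [inner_add_left, inner_add_right, inner_add_right, inner_self_sphere, inner_self_sphere,
      real_inner_comm (A : E3) (B : E3)]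
    linarith
  exact h (eq_neg_of_add_eq_zero_left (inner_self_eq_zero.1 this))

theorem ne_neg_of_detM_pos {A B C : S2} (h : 0 < detM A B C) : (B : E3) ≠ -C := by
  intro h0
  have : detM A B C = 0 := by
    rw [h0, detM_eq_coords]
    simp only [PiLp.neg_apply]
    ring
  exact h.ne' this

theorem detM_eq_mul {A B C X : E3} {a b c : ℝ} (hX : X = a • A + b • B + c • C) :
    detM B C X = a * detM A B C := by
  rw [hX, detM_add, detM_add, detM_smul, detM_smul, detM_smul, detM_self_right, detM_self_outer,
    ← detM_rotate]
  ring

theorem detM_nonneg_of_mem_triangle {A B C X : S2} (h : 0 < detM A B C)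
    (hX : X ∈ triangle A B C) : 0 ≤ detM B C X := by
  obtain ⟨a, b, c, ha, hb, hc, hX⟩ := hX
  rw [detM_eq_mul hX]
  positivity

theorem ne_neg_of_mem_triangle {A B C X : S2} (h : 0 < detM A B C)
    (hX : X ∈ triangle A B C) : (A : E3) ≠ -X := by
  intro h0
  have h1 := detM_nonneg_of_mem_triangle h hX
  have h2 : detM B C X = -detM A B C := by
    rw [detM_rotate A B C, h0]
    simp only [detM_eq_coords, PiLp.neg_apply]
    ring
  linarith

/-- Off the great circle BC the imaginary part is nonzero. On it, X = bB + cC with b, c ≥ 0, and the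
real part (1 + b + c)(1 + B·C) is positive because B and C are not antipodal. -/
theorem halfAreaNumber_mem_slitPlane {A B C X : S2} (h : 0 < detM A B C)
    (hX : X ∈ triangle A B C) : halfAreaNumber B C X ∈ Complex.slitPlane := by
  by_cases hd : detM B C X = 0
  · left
    obtain ⟨a, b, c, ha, hb, hc, hX⟩ := hX
    have ha0 : a = 0 := by
      rw [detM_eq_mul hX] at hd
      exact (mul_eq_zero.1 hd).resolve_right h.ne'
    have hp : 0 < 1 + inner ℝ (B : E3) (C : E3) :=
      lt_of_le_of_ne (by linarith [(abs_le.1 (abs_inner_sphere_le B C)).1])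
        (one_add_inner_ne_zero (ne_neg_of_detM_pos h)).symm
    have : (halfAreaNumber B C X).re = (1 + (b + c)) * (1 + inner ℝ (B : E3) (C : E3)) := by
      simp only [halfAreaNumber]
      rw [real_inner_comm (B : E3) (X : E3), hX, ha0]
      simp only [zero_smul, zero_add, inner_add_right, inner_smul_right, inner_self_sphere,
        real_inner_comm (B : E3) (C : E3)]
      ring
    rw [this]
    positivity
  · exact Or.inr hd

/-- The differential of the area of the triangle `BCX`, as a function of `X`. -/
theorem mdifferentiableAt_and_d_area_div_of_mem_triangle {A B C X : S2} {S : ℝ} (hS : S ≠ 0)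
    (h : 0 < detM A B C) (hX : X ∈ triangle A B C) :
    MDifferentiableAt (𝓡 2) 𝓘(ℝ, ℝ) (fun Y => area B C Y / S) X ∧
      -(S * detM B C X) • d (fun Y => area B C Y / S) X = dotdX (F B C X) X := by
  have h1 : 0 < detM B C A := by rwa [← detM_rotate]
  have h2 : 0 < detM C A B := by rwa [← detM_rotate]
  have hX1 : X ∈ triangle B C A := by rwa [← triangle_rotate]
  have hX2 : X ∈ triangle C A B := by rwa [← triangle_rotate]
  exact mdifferentiableAt_and_d_area_div hS (halfAreaNumber_mem_slitPlane h hX)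
    (one_add_inner_ne_zero (ne_neg_of_detM_pos h))
    (one_add_inner_ne_zero (ne_neg_of_mem_triangle h1 hX1))
    (one_add_inner_ne_zero (ne_neg_of_mem_triangle h2 hX2))

/-! ### Additivity of the area -/

theorem toSphere_great_circle {n : E3} (hn : n ≠ 0) :
    (volume : Measure E3).toSphere {X : S2 | inner ℝ n (X : E3) = 0} = 0 := by
  have h := toSphere_real_preimage (Q := {x : E3 | inner ℝ n x = 0})
    (measurableSet_eq_fun (by fun_prop) measurable_const)
    (fun r hr x => by simp [inner_smul_right, hr.ne'])
  rw [measureReal_def (s := _ ∩ _), measure_mono_null inter_subset_left (volume_plane hn),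
    ENNReal.toReal_zero, mul_zero, measureReal_eq_zero_iff] at h
  exact h

theorem toSphere_triangle_of_detM_eq_zero {A B C : S2} (hn : cross A B ≠ 0)
    (h : detM A B C = 0) : (volume : Measure E3).toSphere (triangle A B C) = 0 := by
  refine measure_mono_null ?_ (toSphere_great_circle hn)
  rintro X ⟨a, b, c, -, -, -, hX⟩
  change inner ℝ (cross A B) (X : E3) = 0
  rw [inner_cross, hX, detM_add, detM_add, detM_smul, detM_smul, detM_smul, detM_self_right,
    detM_self_outer, h]
  ring

theorem area_eq_measure_of_nonneg {A B C : S2} (hn : cross A B ≠ 0) (h : 0 ≤ detM A B C) :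
    area A B C = (volume : Measure E3).toSphere.real (triangle A B C) := by
  rcases h.eq_or_lt with h | h
  · rw [area_eq_zero_of_detM_eq_zero h.symm, measureReal_def,
      toSphere_triangle_of_detM_eq_zero hn h.symm, ENNReal.toReal_zero]
  · exact area_eq_measure h

theorem nullMeasurableSet_triangle {A B C : S2} (hn : cross A B ≠ 0) (h : 0 ≤ detM A B C) :
    NullMeasurableSet (triangle A B C) (volume : Measure E3).toSphere := by
  rcases h.eq_or_lt with h | h
  · exact .of_null (toSphere_triangle_of_detM_eq_zero hn h.symm)
  · have (v : E3) : MeasurableSet {x : E3 | 0 ≤ inner ℝ v x} :=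
      measurableSet_le measurable_const (by fun_prop)
    rw [triangle_eq_preimage h]
    exact (measurable_subtype_coe
      ((this _).inter ((this _).inter (this _)))).nullMeasurableSet

/-- The great circle through C and X separates the two triangles: at a common point Y, det M(C,X,Y)
is both nonnegative and nonpositive, so Y lies on that null circle. If det M(B,C,X) = 0, the first
triangle is itself null. -/
theorem aedisjoint_triangle {A B C X : S2} (hn : cross B C ≠ 0)
    (h1 : 0 ≤ detM B C X) (h2 : 0 ≤ detM C A X) :
    AEDisjoint (volume : Measure E3).toSphere (triangle B C X) (triangle C A X) := by
  rcases h1.eq_or_lt with h | h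
  · exact measure_mono_null inter_subset_left (toSphere_triangle_of_detM_eq_zero hn h.symm)
  · have hn' : cross C X ≠ 0 :=
      cross_ne_zero_of_detM_ne_zero (w := (B : E3)) (by rw [← detM_rotate]; exact h.ne')
    refine measure_mono_null ?_ (toSphere_great_circle hn')
    rintro Y ⟨⟨b, c, x, hb, hc, hx, hY⟩, ⟨c', a, x', hc', ha, hx', hY'⟩⟩
    have e1 : detM C X Y = b * detM B C X := detM_eq_mul hY
    have e2 : detM C X Y = -(a * detM C A X) := by
      rw [hY', detM_add, detM_add, detM_smul, detM_smul, detM_smul, detM_self_right,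
        detM_self_outer, detM_swap C A X]
      ring
    change inner ℝ (cross C X) (Y : E3) = 0
    rw [inner_cross]
    linarith [mul_nonneg hb h1, mul_nonneg ha h2]

/-- The index minimizes a i / p i over p i > 0. With p and a the cone coordinates of X and Y, it
tells which vertex X replaces in a smaller triangle containing Y. -/
theorem exists_pos_forall_mul_le {ι : Type*} [Fintype ι] {p a : ι → ℝ} (hp : ∀ i, 0 ≤ p i)
    (ha : ∀ i, 0 ≤ a i) (hne : ∃ i, p i ≠ 0) :
    ∃ i, 0 < p i ∧ ∀ j, a i * p j ≤ a j * p i := by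
  classical
  obtain ⟨i₀, hi₀⟩ := hne
  obtain ⟨i, hi, hmin⟩ := (Finset.univ.filter fun i => 0 < p i).exists_min_image
    (fun i => a i / p i) ⟨i₀, by simpa using lt_of_le_of_ne (hp i₀) hi₀.symm⟩
  simp only [Finset.mem_filter, Finset.mem_univ, true_and] at hi hmin
  refine ⟨i, hi, fun j => ?_⟩
  rcases (hp j).eq_or_lt with hj | hj
  · rw [← hj, mul_zero]
    exact mul_nonneg (ha j) hi.le
  · exact (div_le_div_iff₀ hi hj).1 (hmin j hj)

/-- Subtracting (a/p)X from Y removes the A-component; the two inequalities keep the remaining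
coefficients nonnegative. -/
theorem mem_triangle_of_mul_le {A B C X Y : S2} {a b c p q r : ℝ} (hp : 0 < p) (ha : 0 ≤ a)
    (hX : (X : E3) = p • (A : E3) + q • (B : E3) + r • (C : E3))
    (hY : (Y : E3) = a • (A : E3) + b • (B : E3) + c • (C : E3))
    (hb : a * q ≤ b * p) (hc : a * r ≤ c * p) : Y ∈ triangle B C X := by
  refine ⟨b - a * q / p, c - a * r / p, a / p, ?_, ?_, by positivity, ?_⟩
  · rw [sub_nonneg, div_le_iff₀ hp]
    exact hb
  · rw [sub_nonneg, div_le_iff₀ hp]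
    exact hc
  · rw [hX, hY]
    match_scalars <;> field_simp <;> ring

theorem triangle_subset {A B C X : S2} (hX : X ∈ triangle A B C) :
    triangle B C X ⊆ triangle A B C := by
  obtain ⟨p, q, r, hp, hq, hr, hX⟩ := hX
  rintro Y ⟨b, c, x, hb, hc, hx, hY⟩
  refine ⟨x * p, b + x * q, c + x * r, by positivity, by positivity, by positivity, ?_⟩
  rw [hY, hX]
  module

theorem triangle_eq_union {A B C X : S2} (hX : X ∈ triangle A B C) :
    triangle A B C = triangle B C X ∪ triangle C A X ∪ triangle A B X := by
  apply subset_antisymm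
  · obtain ⟨p, q, r, hp, hq, hr, hX⟩ := hX
    rintro Y ⟨a, b, c, ha, hb, hc, hY⟩
    have hX1 : (X : E3) = q • (B : E3) + r • (C : E3) + p • (A : E3) := by rw [hX]; abel
    have hX2 : (X : E3) = r • (C : E3) + p • (A : E3) + q • (B : E3) := by rw [hX]; abel
    have hY1 : (Y : E3) = b • (B : E3) + c • (C : E3) + a • (A : E3) := by rw [hY]; abel
    have hY2 : (Y : E3) = c • (C : E3) + a • (A : E3) + b • (B : E3) := by rw [hY]; abel
    obtain ⟨i, hi, hmin⟩ := exists_pos_forall_mul_le (p := ![p, q, r]) (a := ![a, b, c])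
      (by intro i; fin_cases i <;> assumption) (by intro i; fin_cases i <;> assumption) (by
        by_contra! h
        have h0 : p = 0 := h 0
        have h1 : q = 0 := h 1
        have h2 : r = 0 := h 2
        rw [h0, h1, h2, zero_smul, zero_smul, zero_smul, add_zero, add_zero] at hX
        exact ne_zero_of_mem_unit_sphere X hX)
    have m0 := hmin 0
    have m1 := hmin 1
    have m2 := hmin 2
    fin_cases i
    · exact Or.inl (Or.inl (mem_triangle_of_mul_le hi ha hX hY m1 m2))
    · exact Or.inl (Or.inr (mem_triangle_of_mul_le hi hb hX1 hY1 m2 m0))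
    · exact Or.inr (mem_triangle_of_mul_le hi hc hX2 hY2 m0 m1)
  · refine union_subset (union_subset (triangle_subset hX) ?_) ?_
    · rw [triangle_rotate A B C] at hX ⊢
      exact triangle_subset hX
    · rw [← triangle_rotate C A B] at hX ⊢
      exact triangle_subset hX

/-- For X in the closed triangle all three orientations are nonnegative, so the oriented areas are
plain measures, also when a piece degenerates. -/
theorem area_add_area_add_area {A B C X : S2} (h : 0 < detM A B C) (hX : X ∈ triangle A B C) :
    area B C X + area C A X + area A B X = area A B C := by
  have h1 : 0 < detM B C A := by rwa [← detM_rotate]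
  have h2 : 0 < detM C A B := by rwa [← detM_rotate]
  have d1 : 0 ≤ detM B C X := detM_nonneg_of_mem_triangle h hX
  have d2 : 0 ≤ detM C A X := detM_nonneg_of_mem_triangle h1 (by rwa [← triangle_rotate])
  have d3 : 0 ≤ detM A B X := detM_nonneg_of_mem_triangle h2 (by rwa [triangle_rotate])
  have c1 := cross_ne_zero_of_detM_ne_zero h1.ne'
  have c2 := cross_ne_zero_of_detM_ne_zero h2.ne'
  have c3 := cross_ne_zero_of_detM_ne_zero h.ne'
  rw [area_eq_measure h, triangle_eq_union hX, measureReal_union₀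
      (nullMeasurableSet_triangle c3 d3)
      (AEDisjoint.union_left (aedisjoint_triangle c3 d3 d1).symm (aedisjoint_triangle c2 d2 d3)),
    measureReal_union₀ (nullMeasurableSet_triangle c2 d2) (aedisjoint_triangle c1 d1 d2),
    area_eq_measure_of_nonneg c1 d1, area_eq_measure_of_nonneg c2 d2,
    area_eq_measure_of_nonneg c3 d3]

/-! ### Vanishing on the sides and Whitney forms -/

theorem area_eq_zero_of_mem_arc {A B X : S2} (hX : X ∈ arc A B) : area A B X = 0 := by
  obtain ⟨a, b, -, -, hX⟩ := hX
  apply area_eq_zero_of_detM_eq_zero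
  rw [hX, detM_add, detM_smul, detM_smul, detM_self_right, detM_self_outer]
  ring

theorem F_comm (B C X : S2) : F B C X = F C B X := add_comm _ _

theorem dotdX_smul (r : ℝ) (V : E3) (X : S2) : dotdX (r • V) X = r • dotdX V X := by
  simp only [dotdX, map_smul, ContinuousLinearMap.smul_comp]

theorem dotdX_sub (V W : E3) (X : S2) : dotdX (V - W) X = dotdX V X - dotdX W X := by
  simp only [dotdX, map_sub, ContinuousLinearMap.sub_comp]

theorem eq_neg_dotdX_of_smul_eq {S D : ℝ} (hS : S ≠ 0) (hD : D ≠ 0) {V : E3} {X : S2}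
    {ω : TangentSpace (𝓡 2) X →L[ℝ] ℝ} (h : -(S * D) • ω = dotdX V X) :
    ω = -dotdX ((1 / (S * D)) • V) X := by
  rw [dotdX_smul, ← h]
  ext t
  change ω t = -(1 / (S * D) * (-(S * D) * ω t))
  field_simp

theorem smul_sub_smul_eq_dotdX {S D E l m : ℝ} {V W : E3} {X : S2}
    {ω η : TangentSpace (𝓡 2) X →L[ℝ] ℝ} (hω : ω = -dotdX ((1 / (S * D)) • V) X)
    (hη : η = -dotdX ((1 / (S * E)) • W) X) :
    l • η - m • ω = dotdX ((1 / S) • ((m / D) • V - (l / E) • W)) X := by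
  rw [hω, hη]
  simp only [dotdX_smul, dotdX_sub, smul_sub, smul_neg, smul_smul]
  have e1 : m * (1 / (S * D)) = 1 / S * (m / D) := by
    rw [one_div, mul_inv, one_div, div_eq_mul_inv]; ring
  have e2 : l * (1 / (S * E)) = 1 / S * (l / E) := by
    rw [one_div, mul_inv, one_div, div_eq_mul_inv]; ring
  rw [e1, e2]
  abel

end SphericalTriangle

theorem mainTheorem5 (A B C : S2) (hABC : 0 < detM A B C) :
    -- the values at the vertices
    (lamA A B C A = 1 ∧ lamB A B C B = 1 ∧ lamC A B C C = 1) ∧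
    -- each coordinate vanishes on the side opposite to its vertex
    (∀ X ∈ arc B C, lamA A B C X = 0) ∧
    (∀ X ∈ arc C A, lamB A B C X = 0) ∧
    (∀ X ∈ arc A B, lamC A B C X = 0) ∧
    ∀ X ∈ triangle A B C,
      -- the three areas sum to the total area, the coordinates to one
      area B C X + area C A X + area A B X = area A B C ∧
      lamA A B C X + lamB A B C X + lamC A B C X = 1 ∧
      -- the exterior derivatives of the coordinates exist
      MDifferentiableAt (𝓡 2) 𝓘(ℝ, ℝ) (lamA A B C) X ∧
      MDifferentiableAt (𝓡 2) 𝓘(ℝ, ℝ) (lamB A B C) X ∧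
      MDifferentiableAt (𝓡 2) 𝓘(ℝ, ℝ) (lamC A B C) X ∧
      -- the formulas for them with the denominators cleared, on the whole closed triangle
      -(area A B C * detM B C X) • d (lamA A B C) X = dotdX (F B C X) X ∧
      -(area A B C * detM C A X) • d (lamB A B C) X = dotdX (F C A X) X ∧
      -(area A B C * detM A B X) • d (lamC A B C) X = dotdX (F A B X) X ∧
      -- the formulas for the exterior derivatives, where the denominators are not zero
      (detM B C X ≠ 0 →
        d (lamA A B C) X = -dotdX ((1 / (area A B C * detM B C X)) • F B C X) X) ∧
      (detM C A X ≠ 0 →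
        d (lamB A B C) X = -dotdX ((1 / (area A B C * detM C A X)) • F C A X) X) ∧
      (detM A B X ≠ 0 →
        d (lamC A B C) X = -dotdX ((1 / (area A B C * detM A B X)) • F A B X) X) ∧
      -- the Whitney 1-forms of the three sides
      (detM B C X ≠ 0 → detM C A X ≠ 0 →
        whitney (lamA A B C) (lamB A B C) X =
          dotdX ((1 / area A B C) • ((lamB A B C X / detM B C X) • F B C X -
            (lamA A B C X / detM C A X) • F A C X)) X) ∧
      (detM C A X ≠ 0 → detM A B X ≠ 0 →
        whitney (lamB A B C) (lamC A B C) X =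
          dotdX ((1 / area A B C) • ((lamC A B C X / detM C A X) • F C A X -
            (lamB A B C X / detM A B X) • F B A X)) X) ∧
      (detM A B X ≠ 0 → detM B C X ≠ 0 →
        whitney (lamC A B C) (lamA A B C) X =
          dotdX ((1 / area A B C) • ((lamA A B C X / detM A B X) • F A B X -
            (lamC A B C X / detM B C X) • F C B X)) X) := by
  have h1 : 0 < detM B C A := by rwa [← detM_rotate]
  have h2 : 0 < detM C A B := by rwa [← detM_rotate]
  have hS : area A B C ≠ 0 := (area_pos hABC).ne'
  refine ⟨⟨?_, ?_, div_self hS⟩, fun X hX => ?_, fun X hX => ?_, fun X hX => ?_, fun X hX => ?_⟩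
  · rw [lamA, ← area_rotate, div_self hS]
  · rw [lamB, area_rotate, div_self hS]
  · rw [lamA, area_eq_zero_of_mem_arc hX, zero_div]
  · rw [lamB, area_eq_zero_of_mem_arc hX, zero_div]
  · rw [lamC, area_eq_zero_of_mem_arc hX, zero_div]
  have hsum := area_add_area_add_area hABC hX
  obtain ⟨mA, dA⟩ := mdifferentiableAt_and_d_area_div_of_mem_triangle hS hABC hX
  obtain ⟨mB, dB⟩ := mdifferentiableAt_and_d_area_div_of_mem_triangle hS h1
    (by rwa [← triangle_rotate])
  obtain ⟨mC, dC⟩ := mdifferentiableAt_and_d_area_div_of_mem_triangle hS h2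
    (by rwa [triangle_rotate])
  have eA (h : detM B C X ≠ 0) := eq_neg_dotdX_of_smul_eq hS h dA
  have eB (h : detM C A X ≠ 0) := eq_neg_dotdX_of_smul_eq hS h dB
  have eC (h : detM A B X ≠ 0) := eq_neg_dotdX_of_smul_eq hS h dC
  refine ⟨hsum, ?_, mA, mB, mC, dA, dB, dC, eA, eB, eC, fun hA hB => ?_, fun hB hC => ?_,
    fun hC hA => ?_⟩
  · rw [lamA, lamB, lamC, ← add_div, ← add_div, hsum, div_self hS]
  -- The formula for dλ_B carries F_CA, whereas the Whitney form is written with F_AC; the field is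
  -- symmetric in its two vertices.
  · rw [F_comm A C]
    exact smul_sub_smul_eq_dotdX (eA hA) (eB hB)
  · rw [F_comm B A]
    exact smul_sub_smul_eq_dotdX (eB hB) (eC hC)
  · rw [F_comm C B]
    exact smul_sub_smul_eq_dotdX (eC hC) (eA hA)
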